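/- **Setting.** A topological space is *locally connected* if every point has a basis of connected neighbourhoods. In a locally connected space $X$, a subset $I$ is *negligible* if $X\setminus I$ is open and, for every non-empty connected open set $C\subseteq X$, the set $C\setminus I$ is non-empty and connected. A *negligible subset element* of a space $X$ is a pair $(U,I)$ with $U\subseteq X$ open, $I\subseteq U$, $U$ locally connected, and $I$ negligible in $U$. A continuous map $f:X\to Y$ of locally connected spaces is *diffuse* if $(f^{-1}U,f^{-1}I)$ is a negligible subset element of $X$ for every negligible subset element $(U,I)$ of $Y$. Let $\mathbf{Gen}$ be the category of locally connected spaces and diffuse continuous maps, and let $\mathbf{HGen}^+$ be its full subcategory of locally Hausdorff spaces (spaces covered by open subsets that are Hausdorff). Let $\mathcal C$ be $\mathbf{Gen}$ or $\mathbf{HGen}^+$. Objects, morphisms and pullbacks below are those of $\mathcal C$; a morphism is called connected if its domain is a connected space, and connected spaces are taken to be non-empty. Let $b:B\to A$ be a morphism. * $b$ *overlays absolutely* if it has a pullback along every morphism to $A$, and every pullback $b'$ of $b$ has a kernel pair and is the coequalizer of it. * $b$ is *c-open* if it has a pullback along every morphism to $A$ and, for every pullback $b':B'\to A'$ of $b$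 and every open embedding $u:U\to B'$, one can write $b'\circ u=w\circ f$ with $f$ overlaying absolutely and $w$ an open embedding into $A'$. * $b$ is *c-discrete* if, whenever $Y$ is connected, $f,g:Y\to B$ satisfy $b\circ f=b\circ g$, and $f\circ d=g\circ d$ for some $d:D\to Y$ with $D\neq\emptyset$, then $f=g$. * $b$ is *c-finite of order $n\in\mathbb N$* if for every connected $Y$ and every $c:Y\to A$ there are at most $n$ morphisms $f:Y\to B$ with $b\circ f=c$; it is *c-finite* if this holds for some $n$. **Proposition.** Let $b:B\to A$ be a c-open, c-discrete morphism of $\mathcal C$ that is c-finite of order $n$. Then for each $x\in A$ the fibre $b^{-1}\{x\}$ has at most $n$ elements. Moreover, for each $x\in A$ with $b^{-1}\{x\}\neq\emptyset$ there are a connected, c-finite, c-open, c-discrete morphism $c:C\to A$ and a point $z\in C$ such that $c(z)=x$ and, for each $y\in b^{-1}\{x\}$, there is at least one morphism $f:C\to B$ with $b\circ f=c$ and $f(z)=y$. -/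

import Mathlib

open CategoryTheory CategoryTheory.Limits

universe u v w

namespace Diffuse

/-! ### Negligible sets and diffuse maps -/

/-- An open set `U` is Z-dense in `X` if it meets every non-empty connected open set of `X` in a
non-empty connected set (`IsConnected` includes non-emptiness). -/
def IsZDense {X : Type u} [TopologicalSpace X] (U : Set X) : Prop :=
  IsOpen U ∧ ∀ C : Set X, IsOpen C → IsConnected C → IsConnected (U ∩ C)

/-- A subset is negligible if its complement is (open and) Z-dense. -/
def IsNegligible {X : Type u} [TopologicalSpace X] (I : Set X) : Prop :=
  IsZDense Iᶜ

/-- A pair `(U, I)`, with `U` open in `X` and `I ⊆ U`, is a negligible subset element of `X` if `U`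
is locally connected and `I` is negligible in the space `U`. -/
structure IsNegligibleElement {X : Type u} [TopologicalSpace X] (U I : Set X) : Prop where
  isOpen : IsOpen U
  subset : I ⊆ U
  locallyConnected : LocallyConnectedSpace U
  negligible : IsNegligible (Subtype.val ⁻¹' I : Set U)

/-- A map is diffuse if it is continuous and pulls negligible subset elements back to negligible
subset elements. -/
structure IsDiffuse {X : Type u} {Y : Type v} [TopologicalSpace X] [TopologicalSpace Y]
    (f : X → Y) : Prop where
  continuous : Continuous f
  preimage : ∀ U I : Set Y, IsNegligibleElement U I → IsNegligibleElement (f ⁻¹' U) (f ⁻¹' I)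

theorem IsDiffuse.id {X : Type u} [TopologicalSpace X] : IsDiffuse (fun x : X => x) :=
  ⟨continuous_id, fun _ _ h => h⟩

theorem IsDiffuse.comp {X : Type u} {Y : Type v} {Z : Type w} [TopologicalSpace X]
    [TopologicalSpace Y] [TopologicalSpace Z] {g : Y → Z} {f : X → Y} (hg : IsDiffuse g)
    (hf : IsDiffuse f) : IsDiffuse (fun x => g (f x)) :=
  ⟨hg.continuous.comp hf.continuous, fun U I h => hf.preimage _ _ (hg.preimage U I h)⟩

/-! ### The categories -/

/-- Objects of the category `Gen`: locally connected topological spaces. -/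
structure Gen : Type (u + 1) where
  carrier : Type u
  [top : TopologicalSpace carrier]
  [locallyConnected : LocallyConnectedSpace carrier]

attribute [instance] Gen.top Gen.locallyConnected

/-- Morphisms of `Gen`: diffuse continuous maps. -/
@[ext]
structure Gen.Hom (X Y : Gen.{u}) : Type u where
  toFun : X.carrier → Y.carrier
  diffuse : IsDiffuse toFun

instance : Category.{u} Gen.{u} where
  Hom X Y := Gen.Hom X Y
  id X := ⟨fun x => x, IsDiffuse.id⟩
  comp f g := ⟨fun x => g.toFun (f.toFun x), g.diffuse.comp f.diffuse⟩

/-- The forgetful functor from `Gen` to topological spaces. -/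
def Gen.toTop : Gen.{u} ⥤ TopCat.{u} where
  obj X := TopCat.of X.carrier
  map f := TopCat.ofHom ⟨f.toFun, f.diffuse.continuous⟩

/-- The objects of `HGen⁺`: those locally connected spaces that are locally Hausdorff, that is,
covered by open subsets which are Hausdorff in the subset topology. The category `HGen⁺` is the
corresponding full subcategory of `Gen`. -/
def locallyHausdorff : ObjectProperty Gen.{u} := fun X =>
  ∀ x : X.carrier, ∃ U : Set X.carrier, IsOpen U ∧ x ∈ U ∧ T2Space U

/-- The forgetful functor to topological spaces from a full subcategory of `Gen`. -/
def toTop (P : ObjectProperty Gen.{u}) : P.FullSubcategory ⥤ TopCat.{u} :=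
  P.ι ⋙ Gen.toTop

/-! ### Categorical versions of topological notions

These are relative to a category `C` whose objects have underlying spaces, given by a functor
`F : C ⥤ TopCat`; all quantifiers over objects and all pullbacks refer to `C`. -/

section Categorical

variable {C : Type v} [Category.{w} C]

/-- `f` overlays if it has a kernel pair and is the colimit of it, i.e. is its coequalizer. -/
def Overlays : MorphismProperty C := fun X _ f =>
  ∃ (R : C) (p q : R ⟶ X) (h : IsKernelPair f p q), Nonempty (IsColimit (Cofork.ofπ f h.w))

/-- `f` overlays absolutely if it has a pullback along every morphism to its codomain, and every
pullback of it overlays. -/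
def OverlaysAbsolutely : MorphismProperty C := fun _ _ f =>
  HasPullbacksAlong f ∧ (Overlays (C := C)).universally f

variable (F : C ⥤ TopCat.{u})

/-- The formal subsets of the pseudogeometric topology: open embeddings. -/
def IsOpenEmb : MorphismProperty C := fun _ _ f => Topology.IsOpenEmbedding (F.map f)

/-- Every formal subset `u` of the domain has an image: `u ≫ b` is a morphism that overlays
absolutely followed by a formal subset of the codomain. -/
def HasOpenImages : MorphismProperty C := fun B A b =>
  ∀ (U : C) (u : U ⟶ B), IsOpenEmb F u →
    ∃ (W : C) (f : U ⟶ W) (i : W ⟶ A), IsOpenEmb F i ∧ OverlaysAbsolutely f ∧ f ≫ i = u ≫ b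

/-- `b` is c-open: it has a pullback along every morphism to its codomain, and in every pullback of
`b` formal subsets of the domain have images. -/
def IsCOpen : MorphismProperty C := fun _ _ b =>
  HasPullbacksAlong b ∧ (HasOpenImages F).universally b

/-- `b` is c-discrete: two lifts to `B` of the same morphism from a connected object `Y` that agree
after composition with some morphism `D ⟶ Y` from a non-empty `D` are equal. -/
def IsCDiscrete : MorphismProperty C := fun B _ b =>
  ∀ (Y : C), ConnectedSpace (F.obj Y) → ∀ f g : Y ⟶ B, f ≫ b = g ≫ b →
    ∀ (D : C) (d : D ⟶ Y), Nonempty (F.obj D) → d ≫ f = d ≫ g → f = g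

/-- `b` is c-finite of order (at most) `n`: each morphism to `A` from a non-empty connected object
has at most `n` lifts to `B`. -/
def IsCFiniteOfOrder (n : ℕ) : MorphismProperty C := fun B A b =>
  ∀ (Y : C), ConnectedSpace (F.obj Y) → ∀ c : Y ⟶ A, {f : Y ⟶ B | f ≫ b = c}.encard ≤ n

/-- `b` is c-finite: it is c-finite of some order. -/
def IsCFinite : MorphismProperty C := fun _ _ b => ∃ n : ℕ, IsCFiniteOfOrder F n b

end Categorical

end Diffuse

/-! Fix `x` in `A`. Consider connected c-finite, c-open, c-discrete morphisms `c : Y ⟶ A` with a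
point `p` over `x`, and the set `liftValues b c p` of values at `p` of the lifts of `c` through `b`.
This set lies in the fibre over `x` and has at most `n` elements, since `b` is c-finite of order
`n`. It therefore suffices to enlarge it strictly whenever it misses a point `y` of the fibre: after
at most `n` enlargements it is the whole fibre, which gives both assertions.

To enlarge it, pull `b` back along `c` and restrict to a connected open subspace `Y'`. Old lifts
restrict to `Y'` with the same values, and the second projection is a new lift. The pullback is not
known to have a point over `(p, y)`, but c-openness gives a point over `p` whose image lies in any
prescribed neighbourhood of `y` (`IsCOpen.exists_mem_of_isPullback`). A neighbourhood avoiding the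
finitely many old values makes the new value different from all of them; it need not be `y`.

Two facts carry this. Absolutely overlaying morphisms are epimorphisms, hence surjective
(`surjective_of_epi`). A c-discrete morphism has no specializations between distinct points of a
fibre (`IsCDiscrete.eq_of_specializes`), so the avoiding neighbourhood exists. -/

namespace Diffuse

/-! ### Negligible elements, diffuse maps and the auxiliary test spaces. -/

section Topology

open Topology

variable {X : Type u} {Y : Type v} {Z : Type w} [TopologicalSpace X] [TopologicalSpace Y]
  [TopologicalSpace Z]

/-- This form avoids the subspace `U`, so that negligible elements can be moved along open
embeddings. -/
theorem isNegligibleElement_iff [LocallyConnectedSpace X] {U I : Set X} :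
    IsNegligibleElement U I ↔ IsOpen U ∧ I ⊆ U ∧ IsOpen (U \ I) ∧
      ∀ C ⊆ U, IsOpen C → IsConnected C → IsConnected (C \ I) := by
  constructor
  · rintro ⟨hU, hI, -, ho, hc⟩
    have hv := hU.isOpenEmbedding_subtypeVal
    refine ⟨hU, hI, ?_, fun C hCU hC hC' => ?_⟩
    · have := hv.isOpenMap _ ho
      rwa [← Set.preimage_compl, Subtype.image_preimage_coe] at this
    · have := (hc (Subtype.val ⁻¹' C) (hC.preimage hv.continuous)
        (hC'.preimage_of_isOpenMap hv.injective hv.isOpenMap (by simpa using hCU))).image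
          Subtype.val hv.continuous.continuousOn
      rw [← Set.preimage_compl, ← Set.preimage_inter, Subtype.image_preimage_coe] at this
      convert this using 1
      ext x
      have := @hCU x
      simp only [Set.mem_sdiff, Set.mem_inter_iff, Set.mem_compl_iff]
      tauto
  · rintro ⟨hU, hI, ho, hc⟩
    have hv := hU.isOpenEmbedding_subtypeVal
    refine ⟨hU, hI, hU.locallyConnectedSpace, ?_, fun C hC hC' => ?_⟩
    · convert ho.preimage hv.continuous using 1
      ext x
      simp
    · have h₁ := hc (Subtype.val '' C) (by simp) (hv.isOpenMap _ hC)
        (hC'.image _ hv.continuous.continuousOn)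
      convert h₁.preimage_of_isOpenMap hv.injective hv.isOpenMap
        (by rintro _ ⟨⟨x, -, rfl⟩, -⟩; exact ⟨x, rfl⟩) using 1
      ext x
      simp [and_comm]

theorem IsNegligibleElement.preimage_of_isOpenEmbedding [LocallyConnectedSpace X]
    [LocallyConnectedSpace Y] {f : X → Y} (hf : IsOpenEmbedding f) {U I : Set Y}
    (h : IsNegligibleElement U I) : IsNegligibleElement (f ⁻¹' U) (f ⁻¹' I) := by
  rw [isNegligibleElement_iff] at h ⊢
  obtain ⟨hU, hI, ho, hc⟩ := h
  refine ⟨hU.preimage hf.continuous, Set.preimage_mono hI, ho.preimage hf.continuous,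
    fun C hCU hC hC' => ?_⟩
  convert (hc (f '' C) (by simpa using hCU) (hf.isOpenMap _ hC)
    (hC'.image _ hf.continuous.continuousOn)).preimage_of_isOpenMap hf.injective hf.isOpenMap
      (by rintro _ ⟨⟨x, -, rfl⟩, -⟩; exact ⟨x, rfl⟩) using 1
  rw [Set.preimage_sdiff, Set.preimage_image_eq _ hf.injective]

theorem IsNegligibleElement.image_of_isOpenEmbedding [LocallyConnectedSpace X]
    [LocallyConnectedSpace Y] {f : X → Y} (hf : IsOpenEmbedding f) {U I : Set X}
    (h : IsNegligibleElement U I) : IsNegligibleElement (f '' U) (f '' I) := by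
  rw [isNegligibleElement_iff] at h ⊢
  obtain ⟨hU, hI, ho, hc⟩ := h
  refine ⟨hf.isOpenMap _ hU, Set.image_mono hI, ?_, fun C hCU hC hC' => ?_⟩
  · rw [← Set.image_sdiff hf.injective]
    exact hf.isOpenMap _ ho
  · have hCr : C ⊆ Set.range f := hCU.trans (Set.image_subset_range _ _)
    have hCU' : f ⁻¹' C ⊆ U := by
      rw [← Set.preimage_image_eq U hf.injective]
      exact Set.preimage_mono hCU
    have := (hc (f ⁻¹' C) hCU' (hC.preimage hf.continuous)
      (hC'.preimage_of_isOpenMap hf.injective hf.isOpenMap hCr)).image f hf.continuous.continuousOn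
    rwa [Set.image_sdiff hf.injective, Set.image_preimage_eq_of_subset hCr] at this

theorem IsDiffuse.of_isOpenEmbedding [LocallyConnectedSpace X] [LocallyConnectedSpace Y]
    {f : X → Y} (hf : IsOpenEmbedding f) : IsDiffuse f :=
  ⟨hf.continuous, fun _ _ h => h.preimage_of_isOpenEmbedding hf⟩

/-- Each negligible element of `Y` is the preimage under `g` of its image, which is a negligible
element of `Z`. -/
theorem IsDiffuse.of_comp_isOpenEmbedding [LocallyConnectedSpace Y] [LocallyConnectedSpace Z]
    {g : Y → Z} (hg : IsOpenEmbedding g) {f : X → Y} (h : IsDiffuse fun x => g (f x)) :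
    IsDiffuse f := by
  refine ⟨hg.isInducing.continuous_iff.2 h.continuous, fun U I hUI => ?_⟩
  have := h.preimage _ _ (hUI.image_of_isOpenEmbedding hg)
  have e : ∀ s : Set Y, (fun x => g (f x)) ⁻¹' (g '' s) = f ⁻¹' s := fun s => by
    ext x
    simp [hg.injective.eq_iff]
  rwa [e, e] at this

theorem locallyConnectedSpace_of_indiscreteTopology [IndiscreteTopology X] :
    LocallyConnectedSpace X := by
  refine locallyConnectedSpace_iff_subsets_isOpen_isConnected.2 fun x U hU =>
    ⟨Set.univ, ?_, isOpen_univ, trivial, ⟨x, trivial⟩, isPreconnected_univ⟩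
  obtain ⟨V, hVU, hV, hx⟩ := mem_nhds_iff.1 hU
  rcases (IndiscreteTopology.isOpen_iff V).1 hV with rfl | rfl
  exacts [hx.elim, hVU]

theorem IsNegligibleElement.empty [LocallyConnectedSpace X] {U : Set X} (hU : IsOpen U) :
    IsNegligibleElement U ∅ :=
  isNegligibleElement_iff.2 ⟨hU, Set.empty_subset _, by simpa using hU, fun C _ _ h => by simpa⟩

/-- Only the empty set is negligible in a non-empty indiscrete space, its complement being open and
non-empty. -/
theorem IsDiffuse.of_indiscreteTopology [LocallyConnectedSpace X] [IndiscreteTopology Y]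
    (f : X → Y) : IsDiffuse f := by
  have hf : Continuous f := continuous_of_indiscreteTopology
  refine ⟨hf, fun U I h => ?_⟩
  have := locallyConnectedSpace_of_indiscreteTopology (X := Y)
  obtain ⟨hU, hI, ho, hc⟩ := isNegligibleElement_iff.1 h
  obtain rfl : I = ∅ := by
    refine Set.eq_empty_of_forall_notMem fun y hy => ?_
    rcases (IndiscreteTopology.isOpen_iff U).1 hU with rfl | rfl
    · exact hI hy
    · obtain ⟨z, hz⟩ := (hc Set.univ subset_rfl hU ⟨⟨y, trivial⟩, isPreconnected_univ⟩).nonempty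
      rcases (IndiscreteTopology.isOpen_iff _).1 ho with e | e
      · rwa [e] at hz
      · have hy' : y ∈ Set.univ \ I := e.ge trivial
        exact hy'.2 hy
  exact .empty (hU.preimage hf)

/-! ### Adjoining a copy of a point -/

/-- The space `X` with a new closed point `new`, a set containing it being a neighbourhood of it if
it is the union of `new` and a neighbourhood of `a`. -/
inductive AdjoinCopy (a : X) : Type u
  | incl (x : X)
  | new

namespace AdjoinCopy

variable {a : X}

instance : TopologicalSpace (AdjoinCopy a) where
  IsOpen s := IsOpen (incl ⁻¹' s) ∧ (new ∈ s → incl a ∈ s)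
  isOpen_univ := ⟨isOpen_univ, fun _ => trivial⟩
  isOpen_inter _ _ hs ht := ⟨hs.1.inter ht.1, fun h => ⟨hs.2 h.1, ht.2 h.2⟩⟩
  isOpen_sUnion S hS := by
    refine ⟨?_, fun ⟨t, ht, hn⟩ => ⟨t, ht, (hS t ht).2 hn⟩⟩
    rw [Set.preimage_sUnion]
    exact isOpen_biUnion fun t ht => (hS t ht).1

theorem isOpen_iff {s : Set (AdjoinCopy a)} :
    IsOpen s ↔ IsOpen (incl ⁻¹' s) ∧ (new ∈ s → incl a ∈ s) :=
  Iff.rfl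

theorem incl_injective {X : Type u} {a : X} :
    Function.Injective (incl : X → AdjoinCopy a) := fun _ _ h => by injection h

theorem isOpenEmbedding_incl : IsOpenEmbedding (incl : X → AdjoinCopy a) := by
  refine .of_continuous_injective_isOpenMap ⟨fun s hs => (isOpen_iff.1 hs).1⟩ incl_injective
    fun s hs => isOpen_iff.2 ⟨?_, ?_⟩
  · rwa [Set.preimage_image_eq _ incl_injective]
  · rintro ⟨x, -, hx⟩
    cases hx

theorem specializes : (incl a : AdjoinCopy a) ⤳ new :=
  specializes_iff_forall_open.2 fun _ hs hn => (isOpen_iff.1 hs).2 hn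

theorem isConnected_of_subset_insert_new {s t : Set (AdjoinCopy a)} (hs : IsConnected s)
    (hst : s ⊆ t) (ht : t ⊆ insert new s) (ha : new ∈ t → incl a ∈ s) : IsConnected t := by
  refine hs.subset_closure hst fun z hz => ?_
  rcases ht hz with rfl | h
  · exact specializes.mem_closed isClosed_closure (subset_closure (ha hz))
  · exact subset_closure h

/-- The map to `X` that sends the new point to `y`. -/
def desc (y : X) : AdjoinCopy a → X
  | incl x => x
  | new => y

theorem continuous_desc {y : X} (h : a ⤳ y) : Continuous (desc y : AdjoinCopy a → X) :=
  ⟨fun _ hs => isOpen_iff.2 ⟨hs, fun hy => h.mem_open hs hy⟩⟩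

theorem isConnected_preimage_incl {s : Set (AdjoinCopy a)} (hs : IsOpen s) (h : IsConnected s) :
    IsConnected (incl ⁻¹' s) := by
  -- Retracting `new` onto `a` maps the open set `s` onto its trace on `X`, because `s` contains
  -- `incl a` if it contains `new`.
  convert h.image _ (continuous_desc (specializes_rfl (x := a))).continuousOn using 1
  ext x
  refine ⟨fun hx => ⟨_, hx, rfl⟩, ?_⟩
  rintro ⟨_ | _, hz, rfl⟩
  exacts [hz, (isOpen_iff.1 hs).2 hz]

instance [LocallyConnectedSpace X] : LocallyConnectedSpace (AdjoinCopy a) := by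
  refine locallyConnectedSpace_iff_subsets_isOpen_isConnected.2 fun z W hW => ?_
  obtain ⟨O, hOW, hO, hz⟩ := mem_nhds_iff.1 hW
  have key := locallyConnectedSpace_iff_subsets_isOpen_isConnected.1 ‹LocallyConnectedSpace X›
  have hi : Continuous (incl : X → AdjoinCopy a) := isOpenEmbedding_incl.continuous
  cases z with
  | incl x =>
    obtain ⟨V, hVO, hV, hx, hc⟩ := key x _ ((hO.preimage hi).mem_nhds hz)
    exact ⟨incl '' V, (Set.image_subset_iff.2 hVO).trans hOW, isOpenEmbedding_incl.isOpenMap _ hV,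
      ⟨x, hx, rfl⟩, hc.image _ hi.continuousOn⟩
  | new =>
    obtain ⟨V, hVO, hV, hx, hc⟩ := key a _ ((hO.preimage hi).mem_nhds ((isOpen_iff.1 hO).2 hz))
    refine ⟨insert new (incl '' V), (Set.insert_subset hz (Set.image_subset_iff.2 hVO)).trans hOW,
      isOpen_iff.2 ⟨?_, fun _ => .inr ⟨a, hx, rfl⟩⟩, .inl rfl,
      isConnected_of_subset_insert_new (hc.image _ hi.continuousOn) (Set.subset_insert _ _)
        subset_rfl fun _ => ⟨a, hx, rfl⟩⟩
    convert hV using 1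
    ext x
    simp

theorem isDiffuse_desc [LocallyConnectedSpace X] {y : X} (h : a ⤳ y) :
    IsDiffuse (desc y : AdjoinCopy a → X) := by
  have hd := continuous_desc h
  refine ⟨hd, fun U I hUI => ?_⟩
  rw [isNegligibleElement_iff] at hUI ⊢
  obtain ⟨hU, hI, ho, hc⟩ := hUI
  refine ⟨hU.preimage hd, Set.preimage_mono hI, ho.preimage hd, fun C hCU hC hC' => ?_⟩
  have hi : Continuous (incl : X → AdjoinCopy a) := isOpenEmbedding_incl.continuous
  refine isConnected_of_subset_insert_new
    ((hc (incl ⁻¹' C) (fun x hx => hCU hx) (hC.preimage hi)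
      (isConnected_preimage_incl hC hC')).image incl hi.continuousOn) ?_ ?_ ?_
  · rintro _ ⟨x, hx, rfl⟩
    exact hx
  · rintro (x | _) hx
    exacts [.inr ⟨x, hx, rfl⟩, .inl rfl]
  · intro hn
    -- If `new` survives the removal of the negligible set, then `y` lies in the open set `U \ I`,
    -- hence so does `a`; thus `new` is in the closure of the connected part in `X`.
    exact ⟨a, ⟨(isOpen_iff.1 hC).2 hn.1, (h.mem_open ho ⟨hCU hn.1, hn.2⟩).2⟩, rfl⟩

instance [ConnectedSpace X] : ConnectedSpace (AdjoinCopy a) := by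
  rw [connectedSpace_iff_univ]
  refine isConnected_of_subset_insert_new
    (isConnected_univ.image (incl : X → AdjoinCopy a) isOpenEmbedding_incl.continuous.continuousOn)
    (Set.subset_univ _) ?_ fun _ => ⟨a, trivial, rfl⟩
  rintro (x | _) -
  exacts [.inr ⟨x, trivial, rfl⟩, .inl rfl]

end AdjoinCopy

/-! ### Doubling a point -/

/-- The gluing of two copies of `X` along the complement of the point `a`. -/
inductive DoublePoint (a : X) : Type u
  | incl (x : X)
  | copy

namespace DoublePoint

variable {a : X}

open Classical in
/-- The second inclusion of `X` into the space in which `a` is doubled. -/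
noncomputable def incl' (x : X) : DoublePoint a :=
  if x = a then copy else incl x

noncomputable instance : TopologicalSpace (DoublePoint a) :=
  .coinduced (Sum.elim incl incl') inferInstance

theorem isOpen_iff {s : Set (DoublePoint a)} :
    IsOpen s ↔ IsOpen (incl ⁻¹' s) ∧ IsOpen (incl' ⁻¹' s) := by
  rw [isOpen_coinduced, isOpen_sum_iff]
  rfl

theorem isOpenEmbedding_incl [T1Space X] : IsOpenEmbedding (incl : X → DoublePoint a) := by
  have hi : Function.Injective (incl : X → DoublePoint a) := fun _ _ h => by injection h
  refine .of_continuous_injective_isOpenMap ⟨fun s hs => (isOpen_iff.1 hs).1⟩ hi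
    fun s hs => isOpen_iff.2 ⟨?_, ?_⟩
  · rwa [Set.preimage_image_eq _ hi]
  · convert hs.sdiff (isClosed_singleton (x := a)) using 1
    ext x
    by_cases hx : x = a <;> simp [incl', hx]

theorem isOpenEmbedding_incl' [T1Space X] : IsOpenEmbedding (incl' : X → DoublePoint a) := by
  have hi : Function.Injective (incl' : X → DoublePoint a) := fun x y h => by
    by_cases hx : x = a <;> by_cases hy : y = a <;> simp_all [incl']
  refine .of_continuous_injective_isOpenMap ⟨fun s hs => (isOpen_iff.1 hs).2⟩ hi
    fun s hs => isOpen_iff.2 ⟨?_, ?_⟩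
  · convert hs.sdiff (isClosed_singleton (x := a)) using 1
    ext x
    simp only [Set.mem_preimage, Set.mem_image, Set.mem_sdiff, Set.mem_singleton_iff]
    constructor
    · rintro ⟨y, hy, e⟩
      by_cases hya : y = a <;> simp_all [incl']
    · rintro ⟨hx, hxa⟩
      exact ⟨x, hx, by simp [incl', hxa]⟩
  · rwa [Set.preimage_image_eq _ hi]

theorem exists_isOpenEmbedding [T1Space X] (z : DoublePoint a) :
    ∃ j : X → DoublePoint a, IsOpenEmbedding j ∧ z ∈ Set.range j := by
  cases z with
  | incl x => exact ⟨_, isOpenEmbedding_incl, x, rfl⟩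
  | copy => exact ⟨_, isOpenEmbedding_incl', a, by simp [incl']⟩

instance [T1Space X] [LocallyConnectedSpace X] : LocallyConnectedSpace (DoublePoint a) := by
  refine locallyConnectedSpace_iff_subsets_isOpen_isConnected.2 fun z W hW => ?_
  obtain ⟨j, hj, x, rfl⟩ := exists_isOpenEmbedding z
  obtain ⟨V, hVW, hV, hx, hc⟩ := locallyConnectedSpace_iff_subsets_isOpen_isConnected.1
    ‹LocallyConnectedSpace X› x _ (hj.continuous.continuousAt hW)
  exact ⟨j '' V, Set.image_subset_iff.2 hVW, hj.isOpenMap _ hV, ⟨x, hx, rfl⟩,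
    hc.image _ hj.continuous.continuousOn⟩

theorem exists_isOpen_t2Space [T1Space X] (h : ∀ x : X, ∃ U, IsOpen U ∧ x ∈ U ∧ T2Space U)
    (z : DoublePoint a) : ∃ U, IsOpen U ∧ z ∈ U ∧ T2Space U := by
  obtain ⟨j, hj, x, rfl⟩ := exists_isOpenEmbedding z
  obtain ⟨U, hU, hx, hT⟩ := h x
  exact ⟨j '' U, hj.isOpenMap _ hU, ⟨x, hx, rfl⟩, (hj.isEmbedding.homeomorphImage U).t2Space⟩

end DoublePoint

end Topology

/-! ### Stability of the categorical notions under pullback and composition. -/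

section Categorical

variable {C : Type v} [Category.{w} C]

theorem isPullback_of_mono {W X Y Z : C} {i : W ⟶ X} {j : W ⟶ Y} {f : X ⟶ Z} {u : Y ⟶ Z} [Mono i]
    [Mono u] (w : i ≫ f = j ≫ u)
    (h : ∀ (T : C) (a : T ⟶ X) (b : T ⟶ Y), a ≫ f = b ≫ u → ∃ l : T ⟶ W, l ≫ i = a) :
    IsPullback i j f u := by
  have h' : ∀ s : PullbackCone f u, ∃ l : s.pt ⟶ W, l ≫ i = s.fst :=
    fun s => h _ _ _ s.condition
  choose l hl using h'
  refine ⟨⟨w⟩, ⟨PullbackCone.IsLimit.mk w l hl (fun s => ?_) fun s m hm _ => ?_⟩⟩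
  · rw [← cancel_mono u, Category.assoc, ← w, reassoc_of% hl, s.condition]
  · rw [← cancel_mono i, hm, hl]

theorem hasPullbacksAlong_of_isPullback {X Y X' Y' : C} {f : X ⟶ Y} {f' : X' ⟶ Y'} {i₁ : X' ⟶ X}
    {i₂ : Y' ⟶ Y} (H : IsPullback f' i₁ i₂ f) (hf : HasPullbacksAlong f) :
    HasPullbacksAlong f' := by
  intro W h
  have : HasPullback (h ≫ i₂) f := hf _
  have e : pullback.snd (h ≫ i₂) f ≫ f = (pullback.fst (h ≫ i₂) f ≫ h) ≫ i₂ := by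
    rw [Category.assoc, pullback.condition]
  have K := (IsPullback.of_hasPullback (h ≫ i₂) f).flip
  rw [← H.flip.lift_fst _ _ e] at K
  exact (IsPullback.of_right K (H.flip.lift_snd _ _ e) H.flip).flip.hasPullback

theorem hasPullbacksAlong_comp {X Y Z : C} {f : X ⟶ Y} {g : Y ⟶ Z} (hf : HasPullbacksAlong f)
    (hg : HasPullbacksAlong g) : HasPullbacksAlong (f ≫ g) := by
  intro W h
  have : HasPullback h g := hg h
  have : HasPullback (pullback.snd h g) f := hf _
  exact ((IsPullback.of_hasPullback (pullback.snd h g) f).flip.paste_vert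
    (IsPullback.of_hasPullback h g).flip).flip.hasPullback

theorem exists_factor_of_isPullback_comp {X Y Z X' Z' : C} {f : X ⟶ Y} {g : Y ⟶ Z} {f' : X' ⟶ Z'}
    {i₁ : X' ⟶ X} {i₂ : Z' ⟶ Z} (hg : HasPullbacksAlong g) (H : IsPullback f' i₁ i₂ (f ≫ g)) :
    ∃ (Y' : C) (l : X' ⟶ Y') (m : Y' ⟶ Z') (j : Y' ⟶ Y),
      l ≫ m = f' ∧ IsPullback l i₁ j f ∧ IsPullback m j i₂ g := by
  have : HasPullback i₂ g := hg i₂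
  have e : f' ≫ i₂ = (i₁ ≫ f) ≫ g := by rw [H.w, Category.assoc]
  refine ⟨pullback i₂ g, pullback.lift _ _ e, pullback.fst i₂ g, pullback.snd i₂ g,
    pullback.lift_fst _ _ e, ?_, IsPullback.of_hasPullback i₂ g⟩
  have K := H.flip
  rw [← pullback.lift_fst _ _ e] at K
  exact (IsPullback.of_bot K (pullback.lift_snd _ _ e).symm (IsPullback.of_hasPullback i₂ g).flip).flip

theorem Overlays.epi {X Y : C} {f : X ⟶ Y} (hf : Overlays f) : Epi f := by
  obtain ⟨R, p, q, h, ⟨hc⟩⟩ := hf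
  exact ⟨fun a b e => Cofork.IsColimit.hom_ext hc (by simpa using e)⟩

theorem Overlays.exists_desc {X Y T : C} {f : X ⟶ Y} (hf : Overlays f) (h : X ⟶ T)
    (hh : ∀ (Z : C) (a b : Z ⟶ X), a ≫ f = b ≫ f → a ≫ h = b ≫ h) : ∃ k : Y ⟶ T, f ≫ k = h := by
  obtain ⟨R, p, q, H, ⟨hc⟩⟩ := hf
  exact ⟨Cofork.IsColimit.desc hc h (hh _ _ _ H.w), Cofork.IsColimit.π_desc' hc h _⟩

/-- Together with `Overlays.exists_desc`, this replaces a chosen kernel pair by all pairs of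
morphisms that `f` identifies. -/
theorem Overlays.of_exists_desc {X Y : C} {f : X ⟶ Y} [HasPullback f f] (he : Epi f)
    (hf : ∀ (T : C) (h : X ⟶ T), (∀ (Z : C) (a b : Z ⟶ X), a ≫ f = b ≫ f → a ≫ h = b ≫ h) →
      ∃ k : Y ⟶ T, f ≫ k = h) : Overlays f := by
  have key : ∀ s : Cofork (pullback.fst f f) (pullback.snd f f), ∃ k, f ≫ k = s.π := by
    refine fun s => hf _ _ fun Z a b e => ?_
    have := pullback.lift a b e ≫= s.condition
    rwa [pullback.lift_fst_assoc, pullback.lift_snd_assoc] at this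
  choose k hk using key
  refine ⟨_, _, _, IsPullback.of_hasPullback f f, ⟨Cofork.IsColimit.mk _ k hk fun s m hm => ?_⟩⟩
  rw [← cancel_epi f]
  exact hm.trans (hk s).symm

theorem OverlaysAbsolutely.overlays {X Y : C} {f : X ⟶ Y} (hf : OverlaysAbsolutely f) :
    Overlays f :=
  MorphismProperty.universally_le _ _ hf.2

theorem OverlaysAbsolutely.of_isPullback {X Y X' Y' : C} {f : X ⟶ Y} {f' : X' ⟶ Y'} {i₁ : X' ⟶ X}
    {i₂ : Y' ⟶ Y} (H : IsPullback f' i₁ i₂ f) (hf : OverlaysAbsolutely f) :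
    OverlaysAbsolutely f' :=
  ⟨hasPullbacksAlong_of_isPullback H hf.1, MorphismProperty.of_isPullback H.flip hf.2⟩

theorem OverlaysAbsolutely.id (X : C) : OverlaysAbsolutely (𝟙 X) := by
  refine ⟨fun h => (IsPullback.of_horiz_isIso (fst := 𝟙 _) (snd := h)
    ⟨by simp⟩).hasPullback, fun X' Y' i₁ i₂ f' H => ?_⟩
  have : IsIso f' := H.isIso_fst_of_isIso
  exact Overlays.of_exists_desc inferInstance fun T h _ => ⟨inv f' ≫ h, by simp⟩

theorem OverlaysAbsolutely.overlays_comp {X Y Z : C} {f : X ⟶ Y} {g : Y ⟶ Z}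
    (hf : OverlaysAbsolutely f) (hg : OverlaysAbsolutely g) : Overlays (f ≫ g) := by
  have := hf.overlays.epi
  have := hg.overlays.epi
  have : HasPullback (f ≫ g) (f ≫ g) := hasPullbacksAlong_comp hf.1 hg.1 _
  refine Overlays.of_exists_desc inferInstance fun T h hh => ?_
  obtain ⟨h', rfl⟩ := hf.overlays.exists_desc h fun Z a b e => hh _ _ _ <| by
    rw [reassoc_of% e]
  -- The compatibility of `h'` with `g` is checked after lifting both `a` and `b` to `X`. Two
  -- successive pullbacks of `f` provide these lifts, and they are epimorphisms, so they can be
  -- cancelled.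
  obtain ⟨k, rfl⟩ := hg.overlays.exists_desc h' fun Z a b e => by
    have h₁ : HasPullback a f := hf.1 _
    have h₂ : HasPullback (pullback.fst a f ≫ b) f := hf.1 _
    have := (hf.of_isPullback (IsPullback.of_hasPullback a f)).overlays.epi
    have := (hf.of_isPullback (IsPullback.of_hasPullback (pullback.fst a f ≫ b) f)).overlays.epi
    have e₁ := pullback.condition (f := a) (g := f)
    have e₂ := pullback.condition (f := pullback.fst a f ≫ b) (g := f)
    have := hh _ (pullback.fst (pullback.fst a f ≫ b) f ≫ pullback.snd a f)
      (pullback.snd (pullback.fst a f ≫ b) f) (by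
        simp only [Category.assoc] at e₂ ⊢
        rw [← reassoc_of% e₁, ← reassoc_of% e₂, e])
    simp only [Category.assoc] at this e₂
    rw [← reassoc_of% e₁, ← reassoc_of% e₂] at this
    simpa only [cancel_epi] using this
  exact ⟨k, by simp⟩

theorem OverlaysAbsolutely.comp {X Y Z : C} {f : X ⟶ Y} {g : Y ⟶ Z}
    (hf : OverlaysAbsolutely f) (hg : OverlaysAbsolutely g) : OverlaysAbsolutely (f ≫ g) := by
  refine ⟨hasPullbacksAlong_comp hf.1 hg.1, fun X' Z' i₁ i₂ f' H => ?_⟩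
  obtain ⟨Y', l, m, j, rfl, hl, hm⟩ := exists_factor_of_isPullback_comp hg.1 H
  exact (hf.of_isPullback hl).overlays_comp (hg.of_isPullback hm)

variable (F : C ⥤ TopCat.{u})

theorem IsCOpen.of_isPullback {X Y X' Y' : C} {f : X ⟶ Y} {f' : X' ⟶ Y'} {i₁ : X' ⟶ X}
    {i₂ : Y' ⟶ Y} (H : IsPullback f' i₁ i₂ f) (hf : IsCOpen F f) : IsCOpen F f' :=
  ⟨hasPullbacksAlong_of_isPullback H hf.1, MorphismProperty.of_isPullback H.flip hf.2⟩

theorem IsCOpen.comp {X Y Z : C} {f : X ⟶ Y} {g : Y ⟶ Z} (hf : IsCOpen F f) (hg : IsCOpen F g) :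
    IsCOpen F (f ≫ g) := by
  refine ⟨hasPullbacksAlong_comp hf.1 hg.1, fun X' Z' i₁ i₂ f' H U u hu => ?_⟩
  obtain ⟨Y', l, m, j, rfl, hl, hm⟩ := exists_factor_of_isPullback_comp hg.1 H
  obtain ⟨V, s, v, hv, hs, e₁⟩ := hf.2 _ _ _ hl U u hu
  obtain ⟨W, t, w, hw, ht, e₂⟩ := hg.2 _ _ _ hm V v hv
  exact ⟨W, s ≫ t, w, hw, hs.comp ht, by rw [Category.assoc, e₂, reassoc_of% e₁]⟩

theorem IsOpenEmb.comp {X Y Z : C} {f : X ⟶ Y} {g : Y ⟶ Z} (hf : IsOpenEmb F f)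
    (hg : IsOpenEmb F g) : IsOpenEmb F (f ≫ g) := by
  unfold IsOpenEmb
  rw [F.map_comp, TopCat.coe_comp]
  exact Topology.IsOpenEmbedding.comp hg hf

/-- The image of an open `U` is `U` itself, covered by the identity. -/
theorem IsCOpen.of_isOpenEmb {X Y : C} {f : X ⟶ Y} (hf : HasPullbacksAlong f)
    (hu : (IsOpenEmb F).universally f) : IsCOpen F f :=
  ⟨hf, fun _ _ _ _ f' H U u hU => ⟨U, 𝟙 U, u ≫ f', IsOpenEmb.comp F hU (hu _ _ _ H),
    OverlaysAbsolutely.id U, Category.id_comp _⟩⟩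

theorem IsCDiscrete.of_isPullback {X Y X' Y' : C} {f : X ⟶ Y} {f' : X' ⟶ Y'} {i₁ : X' ⟶ X}
    {i₂ : Y' ⟶ Y} (H : IsPullback f' i₁ i₂ f) (hf : IsCDiscrete F f) : IsCDiscrete F f' := by
  intro T hT a b e D d hD ed
  refine H.hom_ext e (hf T hT _ _ ?_ D d hD (by rw [reassoc_of% ed]))
  rw [Category.assoc, Category.assoc, ← H.w, reassoc_of% e]

theorem IsCDiscrete.comp {X Y Z : C} {f : X ⟶ Y} {g : Y ⟶ Z} (hf : IsCDiscrete F f)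
    (hg : IsCDiscrete F g) : IsCDiscrete F (f ≫ g) := fun T hT a b e D d hD ed =>
  hf T hT a b (hg T hT _ _ (by simpa using e) D d hD (by rw [reassoc_of% ed])) D d hD ed

theorem IsCDiscrete.of_mono {X Y : C} (f : X ⟶ Y) [Mono f] : IsCDiscrete F f :=
  fun _ _ _ _ e _ _ _ _ => (cancel_mono f).1 e

theorem IsCFinite.of_isPullback {X Y X' Y' : C} {f : X ⟶ Y} {f' : X' ⟶ Y'} {i₁ : X' ⟶ X}
    {i₂ : Y' ⟶ Y} (H : IsPullback f' i₁ i₂ f) (hf : IsCFinite F f) : IsCFinite F f' := by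
  obtain ⟨n, hn⟩ := hf
  refine ⟨n, fun T hT c => le_trans ?_ (hn T hT (c ≫ i₂))⟩
  refine Set.encard_le_encard_of_injOn (f := fun a => a ≫ i₁) ?_ ?_
  · rintro a rfl
    simp [H.w]
  · intro a ha b hb e
    exact H.hom_ext (ha.trans hb.symm) e

theorem IsCFinite.comp {X Y Z : C} {f : X ⟶ Y} {g : Y ⟶ Z} (hf : IsCFinite F f)
    (hg : IsCFinite F g) : IsCFinite F (f ≫ g) := by
  obtain ⟨n, hn⟩ := hf
  obtain ⟨m, hm⟩ := hg
  -- There are at most `m` lifts through `g`, each with at most `n` lifts through `f`.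
  refine ⟨m * n, fun T hT c => ?_⟩
  have hfin : {a : T ⟶ Y | a ≫ g = c}.Finite := Set.finite_of_encard_le_coe (hm T hT c)
  have hsub : {a : T ⟶ X | a ≫ f ≫ g = c} ⊆
      ⋃ t ∈ hfin.toFinset, {a : T ⟶ X | a ≫ f = t} := by
    intro a ha
    simpa using ha
  refine (Set.encard_le_encard hsub).trans ?_
  have h₁ : ∀ s : Finset (T ⟶ Y),
      (⋃ t ∈ s, {a : T ⟶ X | a ≫ f = t}).encard ≤ s.card * n := by
    classical
    intro s
    induction s using Finset.induction_on with
    | empty => simp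
    | insert t s hts ih =>
      rw [Finset.set_biUnion_insert, Finset.card_insert_of_notMem hts]
      refine (Set.encard_union_le _ _).trans ?_
      push_cast
      rw [add_mul, one_mul, add_comm]
      exact add_le_add ih (hn T hT t)
  refine (h₁ _).trans ?_
  have h₂ := hm T hT c
  rw [hfin.encard_eq_coe_toFinset_card] at h₂
  push_cast
  gcongr

theorem IsCFinite.of_mono {X Y : C} (f : X ⟶ Y) [Mono f] : IsCFinite F f :=
  ⟨1, fun _ _ _ => Set.encard_le_one_iff.2 fun _ _ ha hb =>
    (cancel_mono f).1 (Eq.trans ha (Eq.symm hb))⟩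

end Categorical

/-! ### Open embeddings in full subcategories of `Gen`. -/

section Concrete

open Topology

theorem locallyHausdorff.t1Space {X : Gen.{u}} (hX : locallyHausdorff X) : T1Space X.carrier := by
  refine t1Space_iff_specializes_imp_eq.2 fun x y hxy => ?_
  obtain ⟨U, hU, hy, hT⟩ := hX y
  have : (⟨x, hxy.mem_open hU hy⟩ : U) ⤳ ⟨y, hy⟩ := (subtype_specializes_iff _ _).2 hxy
  exact congrArg Subtype.val this.eq

theorem locallyHausdorff.of_isOpenEmbedding {X Y : Gen.{u}} {f : X.carrier → Y.carrier}
    (hf : IsOpenEmbedding f) (hY : locallyHausdorff Y) : locallyHausdorff X := by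
  intro x
  obtain ⟨U, hU, hx, hT⟩ := hY (f x)
  refine ⟨f ⁻¹' U, hU.preimage hf.continuous, hx, ?_⟩
  exact T2Space.of_injective_continuous (f := fun z : f ⁻¹' U => (⟨f z, z.2⟩ : U))
    (fun z w h => Subtype.ext (hf.injective (congrArg Subtype.val h)))
    ((hf.continuous.comp continuous_subtype_val).subtype_mk _)

variable {P : ObjectProperty Gen.{u}}

/-- The underlying map of a morphism in a full subcategory of `Gen`. -/
abbrev fn {X Y : P.FullSubcategory} (f : X ⟶ Y) : X.obj.carrier → Y.obj.carrier :=
  f.hom.toFun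

theorem fn_comp {X Y Z : P.FullSubcategory} (f : X ⟶ Y) (g : Y ⟶ Z) (x : X.obj.carrier) :
    fn (f ≫ g) x = fn g (fn f x) :=
  rfl

theorem hom_ext_fn {X Y : P.FullSubcategory} {f g : X ⟶ Y} (h : ∀ x, fn f x = fn g x) : f = g :=
  ObjectProperty.hom_ext _ (Gen.Hom.ext (funext h))

/-- A diffuse map as a morphism in a full subcategory of `Gen`. -/
def homOfDiffuse {X Y : P.FullSubcategory} (f : X.obj.carrier → Y.obj.carrier) (hf : IsDiffuse f) :
    X ⟶ Y :=
  ObjectProperty.homMk ⟨f, hf⟩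

theorem isOpenEmb_iff {X Y : P.FullSubcategory} {f : X ⟶ Y} :
    IsOpenEmb (toTop P) f ↔ IsOpenEmbedding (fn f) :=
  Iff.rfl

theorem IsOpenEmb.mono {X Y : P.FullSubcategory} {f : X ⟶ Y} (hf : IsOpenEmb (toTop P) f) :
    Mono f :=
  ⟨fun g h e => hom_ext_fn fun x => (isOpenEmb_iff.1 hf).injective (by
    rw [← fn_comp, ← fn_comp, e])⟩

theorem IsOpenEmb.exists_lift {X Y T : P.FullSubcategory} {u : X ⟶ Y} (hu : IsOpenEmb (toTop P) u)
    (f : T ⟶ Y) (hf : ∀ t, fn f t ∈ Set.range (fn u)) : ∃ g : T ⟶ X, g ≫ u = f := by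
  choose g hg using hf
  have hd : IsDiffuse fun t => fn u (g t) := by
    simp_rw [hg]
    exact f.hom.diffuse
  exact ⟨homOfDiffuse g (.of_comp_isOpenEmbedding (isOpenEmb_iff.1 hu) hd), hom_ext_fn hg⟩

/-- The class of objects of a full subcategory of `Gen` is closed under open subspaces. -/
def ClosedUnderOpen (P : ObjectProperty Gen.{u}) : Prop :=
  ∀ (X Y : Gen.{u}) (f : X.carrier → Y.carrier), IsOpenEmbedding f → P Y → P X

theorem exists_isOpenEmb (hP : ClosedUnderOpen P) (X : P.FullSubcategory)
    {U : Set X.obj.carrier} (hU : IsOpen U) :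
    ∃ (W : P.FullSubcategory) (i : W ⟶ X), IsOpenEmb (toTop P) i ∧ Set.range (fn i) = U := by
  have := hU.locallyConnectedSpace
  have hi := hU.isOpenEmbedding_subtypeVal
  exact ⟨⟨Gen.mk U, hP _ _ _ hi X.property⟩,
    homOfDiffuse Subtype.val (.of_isOpenEmbedding hi), hi, Subtype.range_val⟩

/-- The pullback is the open preimage of the range of `u`, which is again an object of the
subcategory. -/
theorem IsOpenEmb.exists_isPullback (hP : ClosedUnderOpen P) {U X Z : P.FullSubcategory} {u : U ⟶ X}
    (hu : IsOpenEmb (toTop P) u) (f : Z ⟶ X) :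
    ∃ (W : P.FullSubcategory) (i : W ⟶ Z) (j : W ⟶ U), IsOpenEmb (toTop P) i ∧
      Set.range (fn i) = fn f ⁻¹' Set.range (fn u) ∧ IsPullback i j f u := by
  have := hu.mono
  obtain ⟨W, i, hi, hr⟩ := exists_isOpenEmb hP Z
    ((isOpenEmb_iff.1 hu).isOpen_range.preimage f.hom.diffuse.continuous)
  have := hi.mono
  obtain ⟨j, hj⟩ := hu.exists_lift (i ≫ f) fun t => hr.le ⟨t, rfl⟩
  refine ⟨W, i, j, hi, hr, isPullback_of_mono hj.symm fun T a k e => hi.exists_lift a fun t =>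
    hr.ge ⟨fn k t, ?_⟩⟩
  exact (congrArg (fun m => fn m t) e).symm

theorem IsOpenEmb.of_isPullback (hP : ClosedUnderOpen P) {U X Z W : P.FullSubcategory} {u : U ⟶ X}
    (hu : IsOpenEmb (toTop P) u) {f : Z ⟶ X} {i : W ⟶ Z} {j : W ⟶ U} (H : IsPullback i j f u) :
    IsOpenEmb (toTop P) i := by
  obtain ⟨W', i', j', hi', -, H'⟩ := hu.exists_isPullback hP f
  rw [← H.isoIsPullback_hom_fst _ _ H']
  exact IsOpenEmb.comp _ (TopCat.homeoOfIso ((toTop P).mapIso _)).isOpenEmbedding hi'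

theorem IsCOpen.of_isOpenEmb_closedUnderOpen (hP : ClosedUnderOpen P) {U X : P.FullSubcategory} {u : U ⟶ X}
    (hu : IsOpenEmb (toTop P) u) : IsCOpen (toTop P) u :=
  .of_isOpenEmb _ (fun f => by
    obtain ⟨W, i, j, -, -, H⟩ := hu.exists_isPullback hP f
    exact H.hasPullback) fun _ _ _ _ _ H => hu.of_isPullback hP H

end Concrete

/-! ### Surjectivity of epimorphisms, and the geometry of c-discrete and c-open morphisms. -/

section Surjective

open Topology

theorem closedUnderOpen (P : ObjectProperty Gen.{u}) (hP : P = ⊤ ∨ P = locallyHausdorff) :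
    ClosedUnderOpen P := by
  rcases hP with rfl | rfl
  · exact fun _ _ _ _ _ => trivial
  · exact fun _ _ _ hf h => h.of_isOpenEmbedding hf

theorem surjective_of_epi {P : ObjectProperty Gen.{u}} (hP : P = ⊤ ∨ P = locallyHausdorff)
    {X Y : P.FullSubcategory} (f : X ⟶ Y) [Epi f] : Function.Surjective (fn f) := by
  intro y
  by_contra! hy
  rcases hP with rfl | rfl
  -- In `Gen`, any map to an indiscrete two-point space is a morphism, so a missed point `y` is
  -- detected by its characteristic function.
  · let : TopologicalSpace (ULift.{u} Prop) := ⊤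
    have := locallyConnectedSpace_of_indiscreteTopology (X := ULift.{u} Prop)
    let Z : (⊤ : ObjectProperty Gen.{u}).FullSubcategory := ⟨Gen.mk (ULift.{u} Prop), trivial⟩
    have hZ : IndiscreteTopology Z.obj.carrier := ⟨rfl⟩
    let g : Y ⟶ Z := homOfDiffuse (fun _ => ⟨False⟩) (.of_indiscreteTopology _)
    let h : Y ⟶ Z := homOfDiffuse (fun z => ⟨z = y⟩) (.of_indiscreteTopology _)
    have e : g = h := (cancel_epi f).1 <| hom_ext_fn fun x => by
      change ULift.up False = ULift.up (fn f x = y)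
      simp [hy x]
    have := congrArg (fun k : Y ⟶ Z => (fn k y : ULift Prop).down) e
    change False = (y = y) at this
    simp at this
  -- In the locally Hausdorff case the two inclusions into the space with `y` doubled differ only at
  -- `y`.
  · have := Y.property.t1Space
    let Z : locallyHausdorff.{u}.FullSubcategory :=
      ⟨Gen.mk (DoublePoint y), DoublePoint.exists_isOpen_t2Space Y.property⟩
    let g : Y ⟶ Z := homOfDiffuse DoublePoint.incl
      (.of_isOpenEmbedding DoublePoint.isOpenEmbedding_incl)
    let h : Y ⟶ Z := homOfDiffuse DoublePoint.incl'
      (.of_isOpenEmbedding DoublePoint.isOpenEmbedding_incl')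
    have e : g = h := (cancel_epi f).1 <| hom_ext_fn fun x => by
      change DoublePoint.incl (fn f x) = DoublePoint.incl' (fn f x)
      simp [DoublePoint.incl', hy x]
    have := congrArg (fun k : Y ⟶ Z => fn k y) e
    change DoublePoint.incl y = DoublePoint.incl' y at this
    simp [DoublePoint.incl'] at this

/-- Every point lies in a connected open subspace. -/
theorem exists_connected_isOpenEmb {P : ObjectProperty Gen.{u}} (hP : ClosedUnderOpen P)
    (X : P.FullSubcategory) (x : X.obj.carrier) :
    ∃ (W : P.FullSubcategory) (i : W ⟶ X), IsOpenEmb (toTop P) i ∧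
      ConnectedSpace W.obj.carrier ∧ ∃ w, fn i w = x := by
  obtain ⟨W, i, hi, hr⟩ := exists_isOpenEmb hP X (isOpen_connectedComponent (x := x))
  refine ⟨W, i, hi, ?_, hr.ge mem_connectedComponent⟩
  have h := (isConnected_connectedComponent (x := x)).preimage_of_isOpenMap
    (isOpenEmb_iff.1 hi).injective (isOpenEmb_iff.1 hi).isOpenMap hr.ge
  rw [← hr, Set.preimage_range] at h
  exact connectedSpace_iff_univ.2 h

/-- In `Gen`, a specialization `v ⤳ w` inside a fibre would allow two lifts from a connected space
that agree on a non-empty open subspace and differ at one point. -/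
theorem IsCDiscrete.eq_of_specializes {P : ObjectProperty Gen.{u}}
    (hP : P = ⊤ ∨ P = locallyHausdorff) {A B : P.FullSubcategory} {b : B ⟶ A}
    (hb : IsCDiscrete (toTop P) b) {y z : B.obj.carrier} (h : y ⤳ z) (e : fn b y = fn b z) :
    y = z := by
  obtain ⟨W, i, hi, hW, w, rfl⟩ := exists_connected_isOpenEmb (closedUnderOpen P hP) B z
  obtain ⟨v, rfl⟩ := h.mem_open (isOpenEmb_iff.1 hi).isOpen_range ⟨w, rfl⟩
  have hvw : v ⤳ w := (isOpenEmb_iff.1 hi).isInducing.specializes_iff.1 h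
  rcases hP with rfl | rfl
  -- The new point can be sent to `v` or to `w`. The two maps agree on `W` and have the same
  -- composite with `b`.
  · let Y : (⊤ : ObjectProperty Gen.{u}).FullSubcategory := ⟨Gen.mk (AdjoinCopy v), trivial⟩
    have hY : ConnectedSpace Y.obj.carrier := inferInstanceAs (ConnectedSpace (AdjoinCopy v))
    let d : W ⟶ Y :=
      homOfDiffuse AdjoinCopy.incl (.of_isOpenEmbedding AdjoinCopy.isOpenEmbedding_incl)
    let r (y : W.obj.carrier) (hy : v ⤳ y) : Y ⟶ W :=
      homOfDiffuse (AdjoinCopy.desc y) (AdjoinCopy.isDiffuse_desc hy)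
    have key := hb Y hY (r v specializes_rfl ≫ i) (r w hvw ≫ i) (hom_ext_fn fun t => by
      cases t with
      | incl x => rfl
      | new => exact e) W d ⟨v⟩ (hom_ext_fn fun t => rfl)
    exact congrArg (fun k => fn k AdjoinCopy.new) key
  · have := B.property.t1Space
    exact h.eq

theorem OverlaysAbsolutely.surjective {P : ObjectProperty Gen.{u}}
    (hP : P = ⊤ ∨ P = locallyHausdorff) {X Y : P.FullSubcategory} {f : X ⟶ Y}
    (hf : OverlaysAbsolutely f) : Function.Surjective (fn f) :=
  have := hf.overlays.epi
  surjective_of_epi hP f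

/-- A point over given points exists in a pullback of a c-open morphism, up to moving the point of
the domain inside a given neighbourhood. -/
theorem IsCOpen.exists_mem_of_isPullback {P : ObjectProperty Gen.{u}}
    (hP : P = ⊤ ∨ P = locallyHausdorff) {A B Y Q : P.FullSubcategory} {b : B ⟶ A}
    (hb : IsCOpen (toTop P) b) {c : Y ⟶ A} {r : Q ⟶ Y} {q : Q ⟶ B} (H : IsPullback r q c b)
    {p : Y.obj.carrier} {y : B.obj.carrier} (hpy : fn c p = fn b y) {V : Set B.obj.carrier}
    (hV : IsOpen V) (hy : y ∈ V) : ∃ t, fn r t = p ∧ fn q t ∈ V := by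
  have hPo := closedUnderOpen P hP
  obtain ⟨U, u, hu, hUV⟩ := exists_isOpenEmb hPo B hV
  obtain ⟨y, rfl⟩ := hUV.ge hy
  -- `W` is the open image of `V` in `A`, and `Z` its preimage in `Y`, which contains `p`. The
  -- pullback of `f` to `Z` is surjective, so `p` lifts to a point `s` that also maps into `U`; the
  -- universal property of `Q` then carries `s` to the required point.
  obtain ⟨W, f, w, hw, hf, e⟩ := MorphismProperty.universally_le _ _ hb.2 U u hu
  obtain ⟨Z, i, j, hi, hr, H'⟩ := hw.exists_isPullback hPo c
  have hp : fn c p ∈ Set.range (fn w) :=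
    ⟨fn f y, by rw [← fn_comp, e, hpy]; rfl⟩
  obtain ⟨z, rfl⟩ := hr.ge hp
  have : HasPullback j f := hf.1 j
  obtain ⟨s, rfl⟩ := (hf.of_isPullback (IsPullback.of_hasPullback j f)).surjective hP z
  have e' : (pullback.fst j f ≫ i) ≫ c = (pullback.snd j f ≫ u) ≫ b := by
    rw [Category.assoc, Category.assoc, ← e, H'.w, pullback.condition_assoc]
  refine ⟨fn (H.lift _ _ e') s, ?_, ?_⟩
  · rw [← fn_comp, H.lift_fst, fn_comp]
  · rw [← fn_comp, H.lift_snd, fn_comp]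
    exact hUV.le ⟨_, rfl⟩

end Surjective

/-! ### Enlarging the set of lift values until it fills the fibre. -/

section Points

/-- A morphism with connected domain that is c-finite, c-open and
c-discrete. -/
structure IsConnectedCover {P : ObjectProperty Gen.{u}} {A Y : P.FullSubcategory} (c : Y ⟶ A) :
    Prop where
  connected : ConnectedSpace Y.obj.carrier
  finite : IsCFinite (toTop P) c
  isOpen : IsCOpen (toTop P) c
  discrete : IsCDiscrete (toTop P) c

variable {P : ObjectProperty Gen.{u}}

/-- The values at `p` of the lifts of `c` through `b`. -/
def liftValues {A B Y : P.FullSubcategory} (b : B ⟶ A) (c : Y ⟶ A) (p : Y.obj.carrier) :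
    Set B.obj.carrier :=
  (fun f : Y ⟶ B => fn f p) '' {f | f ≫ b = c}

theorem IsConnectedCover.of_isOpenEmb (hP : ClosedUnderOpen P) {A Y : P.FullSubcategory} {c : Y ⟶ A}
    (hY : ConnectedSpace Y.obj.carrier) (hc : IsOpenEmb (toTop P) c) : IsConnectedCover c :=
  have := hc.mono
  ⟨hY, .of_mono _ c, .of_isOpenEmb_closedUnderOpen hP hc, .of_mono _ c⟩

/-- `Y'` is a connected open piece of the pullback of `b` along `c`, and `g` is the restricted
second projection. The cover properties pass to pullbacks and composites. -/
theorem IsConnectedCover.exists_extension (hP : P = ⊤ ∨ P = locallyHausdorff)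
    {A B Y : P.FullSubcategory} {b : B ⟶ A} (hf : IsCFinite (toTop P) b)
    (ho : IsCOpen (toTop P) b) (hd : IsCDiscrete (toTop P) b) {c : Y ⟶ A} (hc : IsConnectedCover c)
    {p : Y.obj.carrier} {y : B.obj.carrier} (hpy : fn c p = fn b y) {V : Set B.obj.carrier}
    (hV : IsOpen V) (hy : y ∈ V) :
    ∃ (Y' : P.FullSubcategory) (r : Y' ⟶ Y) (g : Y' ⟶ B) (p' : Y'.obj.carrier),
      IsConnectedCover (r ≫ c) ∧ fn r p' = p ∧ g ≫ b = r ≫ c ∧ fn g p' ∈ V := by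
  have hPo := closedUnderOpen P hP
  have : HasPullback c b := ho.1 c
  have H := IsPullback.of_hasPullback c b
  obtain ⟨t, rfl, htV⟩ := ho.exists_mem_of_isPullback hP H hpy hV hy
  obtain ⟨Y', i, hi, hY', p', rfl⟩ := exists_connected_isOpenEmb hPo _ t
  have hi' := IsConnectedCover.of_isOpenEmb hPo hY' hi
  refine ⟨Y', i ≫ pullback.fst c b, i ≫ pullback.snd c b, p', ⟨hY', ?_, ?_, ?_⟩, rfl, ?_, htV⟩
  · exact (hi'.finite.comp _ (hf.of_isPullback _ H)).comp _ hc.finite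
  · exact (hi'.isOpen.comp _ (ho.of_isPullback _ H)).comp _ hc.isOpen
  · exact (hi'.discrete.comp _ (hd.of_isPullback _ H)).comp _ hc.discrete
  · rw [Category.assoc, Category.assoc, pullback.condition]

theorem IsConnectedCover.exists_ssubset_liftValues (hP : P = ⊤ ∨ P = locallyHausdorff)
    {A B Y : P.FullSubcategory} {b : B ⟶ A} (hf : IsCFinite (toTop P) b)
    (ho : IsCOpen (toTop P) b) (hd : IsCDiscrete (toTop P) b) {c : Y ⟶ A} (hc : IsConnectedCover c)
    {p : Y.obj.carrier} (hfin : (liftValues b c p).Finite) {y : B.obj.carrier}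
    (hpy : fn c p = fn b y) (hy : y ∉ liftValues b c p) :
    ∃ (Y' : P.FullSubcategory) (c' : Y' ⟶ A) (p' : Y'.obj.carrier),
      IsConnectedCover c' ∧ fn c' p' = fn c p ∧ liftValues b c p ⊂ liftValues b c' p' := by
  -- Otherwise `s` would specialize to `y` within a fibre of `b`, forcing `s = y`.
  have hsep : ∀ s ∈ liftValues b c p, ∃ V, IsOpen V ∧ y ∈ V ∧ s ∉ V := by
    rintro _ ⟨f, rfl, rfl⟩
    by_contra! h
    refine hy ⟨f, rfl, hd.eq_of_specializes hP (specializes_iff_forall_open.2 h) ?_⟩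
    rw [← hpy, fn_comp]
  choose! V hVo hyV hsV using hsep
  obtain ⟨Y', r, g, p', hc', rfl, hg, hgV⟩ := hc.exists_extension hP hf ho hd hpy
    (hfin.isOpen_biInter hVo) (Set.mem_iInter₂.2 hyV)
  refine ⟨Y', r ≫ c, p', hc', rfl, ?_, fun h => ?_⟩
  · rintro _ ⟨f, rfl, rfl⟩
    exact ⟨r ≫ f, Category.assoc _ _ _, rfl⟩
  · have hm := h ⟨g, hg, rfl⟩
    exact hsV _ hm (Set.mem_iInter₂.1 hgV _ hm)

theorem exists_isConnectedCover_liftValues_eq (hP : P = ⊤ ∨ P = locallyHausdorff)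
    {A B : P.FullSubcategory} {b : B ⟶ A} {n : ℕ} (hf : IsCFiniteOfOrder (toTop P) n b)
    (ho : IsCOpen (toTop P) b) (hd : IsCDiscrete (toTop P) b) (x : A.obj.carrier) :
    ∃ (Y : P.FullSubcategory) (c : Y ⟶ A) (p : Y.obj.carrier), IsConnectedCover c ∧ fn c p = x ∧
      (liftValues b c p).encard ≤ n ∧ liftValues b c p = fn b ⁻¹' {x} := by
  have hle : ∀ {Y : P.FullSubcategory} {c : Y ⟶ A} {p : Y.obj.carrier}, IsConnectedCover c →
      (liftValues b c p).encard ≤ n := fun {Y c p} hc =>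
    (Set.encard_image_le _ _).trans (hf Y hc.connected c)
  by_contra! hne
  -- If no cover attains the whole fibre, the number of lift values grows without bound,
  -- contradicting `hle` at `n + 1`. The start is a connected open neighbourhood of `x`.
  have key : ∀ k : ℕ, ∃ (Y : P.FullSubcategory) (c : Y ⟶ A) (p : Y.obj.carrier),
      IsConnectedCover c ∧ fn c p = x ∧ k ≤ (liftValues b c p).encard := by
    intro k
    induction k with
    | zero =>
      obtain ⟨Y, c, hc, hY, p, hp⟩ := exists_connected_isOpenEmb (closedUnderOpen P hP) A x
      exact ⟨Y, c, p, .of_isOpenEmb (closedUnderOpen P hP) hY hc, hp, by simp⟩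
    | succ k ih =>
      obtain ⟨Y, c, p, hc, rfl, hk⟩ := ih
      have hfin : (liftValues b c p).Finite := Set.finite_of_encard_le_coe (hle hc)
      have hsub : liftValues b c p ⊆ fn b ⁻¹' {fn c p} := by
        rintro _ ⟨f, rfl, rfl⟩
        rfl
      obtain ⟨y, hy, hy'⟩ := Set.exists_of_ssubset (hsub.ssubset_of_ne (hne Y c p hc rfl (hle hc)))
      obtain ⟨Y', c', p', hc', e, hss⟩ :=
        hc.exists_ssubset_liftValues hP ⟨n, hf⟩ ho hd hfin (Eq.symm hy) hy'
      refine ⟨Y', c', p', hc', e, ?_⟩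
      push_cast
      exact (add_le_add_left hk 1).trans (Order.add_one_le_of_lt (hfin.encard_lt_encard hss))
  obtain ⟨Y, c, p, hc, -, hk⟩ := key (n + 1)
  have := hk.trans (hle hc)
  norm_cast at this
  omega

end Points

end Diffuse

/-! ### The proposition for `Gen` and its locally Hausdorff subcategory. -/

theorem mainTheorem8 (P : ObjectProperty Diffuse.Gen.{u})
    (hP : P = ⊤ ∨ P = Diffuse.locallyHausdorff)
    {A B : P.FullSubcategory} (b : B ⟶ A) (n : ℕ)
    (hopen : Diffuse.IsCOpen (Diffuse.toTop P) b)
    (hdisc : Diffuse.IsCDiscrete (Diffuse.toTop P) b)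
    (hfin : Diffuse.IsCFiniteOfOrder (Diffuse.toTop P) n b)
    (x : (Diffuse.toTop P).obj A) :
    ((Diffuse.toTop P).map b ⁻¹' {x}).encard ≤ n ∧
    (((Diffuse.toTop P).map b ⁻¹' {x}).Nonempty →
      ∃ (C : P.FullSubcategory) (c : C ⟶ A) (z : (Diffuse.toTop P).obj C),
        ConnectedSpace ((Diffuse.toTop P).obj C) ∧
        Diffuse.IsCFinite (Diffuse.toTop P) c ∧
        Diffuse.IsCOpen (Diffuse.toTop P) c ∧
        Diffuse.IsCDiscrete (Diffuse.toTop P) c ∧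
        (Diffuse.toTop P).map c z = x ∧
        ∀ y ∈ (Diffuse.toTop P).map b ⁻¹' {x},
          ∃ f : C ⟶ B, f ≫ b = c ∧ (Diffuse.toTop P).map f z = y) := by
  obtain ⟨C, c, z, hc, hz, hle, he⟩ :=
    Diffuse.exists_isConnectedCover_liftValues_eq hP hfin hopen hdisc x
  refine ⟨(congrArg Set.encard he).ge.trans hle, fun _ =>
    ⟨C, c, z, hc.connected, hc.finite, hc.isOpen, hc.discrete, hz, fun y hy => ?_⟩⟩
  obtain ⟨f, hf, hfy⟩ := he.ge hy
  exact ⟨f, hf, hfy⟩
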